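/- Conventions. All probability spaces are standard Borel, and "isomorphism" and equalities of maps are modulo null sets. A measurable flow on a probability space $(X,\mathcal B,\mu)$ is a one-parameter group $\mathcal T=(T^t)_{t\in\mathbb R}$ of automorphisms of $(X,\mathcal B,\mu)$ such that $t\mapsto\langle f\circ T^t,g\rangle$ is continuous for all $f,g\in L^2(\mu)$. It is ergodic if every invariant measurable set has measure $0$ or $1$, and weakly mixing if $\frac1R\int_0^R|\mu(A\cap T^{-t}B)-\mu(A)\mu(B)|\,dt\to0$ as $R\to\infty$ for all measurable $A,B$. For flows $\mathcal T$ on $(X,\mu)$ and $\mathcal S$ on $(Y,\nu)$, $J^e(\mathcal T,\mathcal S)$ is the set of $(T^t\times S^t)_t$-invariant and ergodic probability measures on $X\times Y$ with marginals $\mu$ and $\nu$. An ergodic flow $\mathcal T$ on $(X,\mu)$ has the joining primeness property (JP) if for all weakly mixing flows $\mathcal S_1,\mathcal S_2$ on $(Y_1,\nu_1),(Y_2,\nu_2)$ and every $\lambda\in J^e(\mathcal T,\mathcal S_1\times\mathcal S_2)$ one has $\lambda=\lambda_{X,Y_1}\otimes\nu_2$ or $\lambda=\lambda_{X,Y_2}\otimes\nu_1$,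 where $\lambda_{X,Y_k}$ is the projection of $\lambda$ to $X\times Y_k$ (and the coordinates are put in the obvious order). Proposition. For $i\in\mathbb N$ let $\mathcal T_i$ be a weakly mixing flow with the JP property on $(X_i,\mathcal B_i,\mu_i)$ and let $\mathcal S_i$ be a measurable flow on $(Y_i,\mathcal C_i,\nu_i)$. Let $\Phi\colon Y_1\times Y_2\times\cdots\to X_1\times X_2\times\cdots$ be an isomorphism from the flow $\mathcal S_1\times\mathcal S_2\times\cdots$ to the flow $\mathcal T_1\times\mathcal T_2\times\cdots$ (with the product measures). (1) There are pairwise disjoint sets $\mathbb N_1,\mathbb N_2,\ldots\subset\mathbb N$ with union $\mathbb N$, where $\mathbb N_i\neq\emptyset$ whenever $\nu_i$ is non-trivial (takes a value other than $0$ and $1$), such that for each $i$ the map $\Phi$ determines an isomorphism between $\mathcal S_i$ and $\times_{j\in\mathbb N_i}\mathcal T_j$: there is an isomorphism $\varphi_i\colon Y_i\to\prod_{j\in\mathbb N_i}X_j$ from $\mathcal S_i$ to $\times_{j\in\mathbb N_i}\mathcal T_j$ such that $(\Phi(y)_j)_{j\in\mathbb N_i}=\varphi_i(y_i)$ for almost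 every $y\in Y_1\times Y_2\times\cdots$. (An empty product is the one-point flow.) (2) If in addition all $\mu_i$ and $\nu_i$ are non-trivial and every $\mathcal S_i$ has the JP property, then there is a permutation $\sigma$ of $\mathbb N$ such that for each $i$ the map $\Phi$ determines an isomorphism between $\mathcal S_{\sigma(i)}$ and $\mathcal T_i$: there is an isomorphism $\varphi_i\colon Y_{\sigma(i)}\to X_i$ from $\mathcal S_{\sigma(i)}$ to $\mathcal T_i$ such that $\Phi(y)_i=\varphi_i(y_{\sigma(i)})$ for almost every $y$. -/

import Mathlib

open MeasureTheory Filter Topology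

universe u

namespace MeasFlow

/-- `T = (T^t)_{t ∈ ℝ}` is a measurable flow on the probability space `(X, μ)`: a one-parameter
group of automorphisms of `(X, μ)`, where automorphisms are identified when they agree `μ`-almost
everywhere, such that `t ↦ ⟨f ∘ T^t, g⟩` is continuous for all `f, g ∈ L²(X, μ)`. -/
structure IsFlow {X : Type*} [MeasurableSpace X] (T : ℝ → X → X) (μ : Measure X) : Prop where
  measurePreserving : ∀ t, MeasurePreserving (T t) μ μ
  zero : T 0 =ᵐ[μ] id
  add : ∀ s t, T (s + t) =ᵐ[μ] T s ∘ T t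
  continuous_inner : ∀ f g : X → ℂ, MemLp f 2 μ → MemLp g 2 μ →
    Continuous fun t : ℝ => ∫ x, f (T t x) * (starRingEnd ℂ) (g x) ∂μ

/-- Every (almost everywhere) invariant measurable set has measure `0` or `1`. -/
def IsErgodic {X : Type*} [MeasurableSpace X] (T : ℝ → X → X) (μ : Measure X) : Prop :=
  ∀ A : Set X, MeasurableSet A → (∀ t, T t ⁻¹' A =ᵐ[μ] A) → μ A = 0 ∨ μ A = 1

/-- Weak mixing: `(1/R) ∫₀^R |μ(A ∩ T^{-t} B) - μ(A) μ(B)| dt → 0` as `R → ∞`, for all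
measurable `A, B`. -/
def IsWeaklyMixing {X : Type*} [MeasurableSpace X] (T : ℝ → X → X) (μ : Measure X) : Prop :=
  ∀ A B : Set X, MeasurableSet A → MeasurableSet B →
    Tendsto (fun R : ℝ => R⁻¹ * ∫ t in (0 : ℝ)..R,
      |μ.real (A ∩ T t ⁻¹' B) - μ.real A * μ.real B|) atTop (𝓝 0)

/-- The product flow `T × S`. -/
def prodFlow {X Y : Type*} (T : ℝ → X → X) (S : ℝ → Y → Y) : ℝ → X × Y → X × Y :=
  fun t => Prod.map (T t) (S t)

/-- The product flow `×_{i ∈ ι} T_i`. -/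
def piFlow {ι : Type*} {X : ι → Type*} (T : ∀ i, ℝ → X i → X i) :
    ℝ → (∀ i, X i) → ∀ i, X i :=
  fun t x i => T i t (x i)

/-- `ρ ∈ J^e(T, S)`: `ρ` is an invariant measure of `T × S` with marginals `μ` and `ν`, and
`T × S` is ergodic for it. -/
structure IsErgodicJoining {X Y : Type*} [MeasurableSpace X] [MeasurableSpace Y]
    (T : ℝ → X → X) (μ : Measure X) (S : ℝ → Y → Y) (ν : Measure Y) (ρ : Measure (X × Y)) :
    Prop where
  map_fst : ρ.map Prod.fst = μ
  map_snd : ρ.map Prod.snd = ν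
  invariant : ∀ t, ρ.map (prodFlow T S t) = ρ
  ergodic : IsErgodic (prodFlow T S) ρ

/-- The joining primeness property: `T` is ergodic, and for all weakly mixing flows `S₁, S₂`
each `ρ ∈ J^e(T, S₁ × S₂)` is `ρ_{X,Y₁} ⊗ ν₂` or `ρ_{X,Y₂} ⊗ ν₁`, with the coordinates put back
in the order `X, Y₁, Y₂`. -/
def HasJP {X : Type u} [MeasurableSpace X] (T : ℝ → X → X) (μ : Measure X) : Prop :=
  IsErgodic T μ ∧
  ∀ (Y₁ Y₂ : Type u) [MeasurableSpace Y₁] [StandardBorelSpace Y₁]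
    [MeasurableSpace Y₂] [StandardBorelSpace Y₂]
    (ν₁ : Measure Y₁) [IsProbabilityMeasure ν₁] (ν₂ : Measure Y₂) [IsProbabilityMeasure ν₂]
    (S₁ : ℝ → Y₁ → Y₁) (S₂ : ℝ → Y₂ → Y₂),
    IsFlow S₁ ν₁ → IsWeaklyMixing S₁ ν₁ → IsFlow S₂ ν₂ → IsWeaklyMixing S₂ ν₂ →
    ∀ ρ : Measure (X × (Y₁ × Y₂)),
      IsErgodicJoining T μ (prodFlow S₁ S₂) (ν₁.prod ν₂) ρ →
        ρ = ((ρ.map fun p => (p.1, p.2.1)).prod ν₂).map (fun q => (q.1.1, (q.1.2, q.2))) ∨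
        ρ = ((ρ.map fun p => (p.1, p.2.2)).prod ν₁).map (fun q => (q.1.1, (q.2, q.1.2)))

/-- `φ` is an isomorphism (mod null sets) from the flow `S` on `(Y, ν)` to the flow `T` on
`(X, μ)`. -/
structure IsFlowIso {Y X : Type*} [MeasurableSpace Y] [MeasurableSpace X]
    (S : ℝ → Y → Y) (ν : Measure Y) (T : ℝ → X → X) (μ : Measure X) (φ : Y → X) : Prop where
  measurePreserving : MeasurePreserving φ ν μ
  exists_inverse : ∃ ψ : X → Y, Measurable ψ ∧ ψ ∘ φ =ᵐ[ν] id ∧ φ ∘ ψ =ᵐ[μ] id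
  equivariant : ∀ t, φ ∘ S t =ᵐ[ν] T t ∘ φ

/-- The probability space `(X, μ)` is not a one-point space mod null sets. -/
def IsNontrivial {X : Type*} [MeasurableSpace X] (μ : Measure X) : Prop :=
  ∃ A : Set X, MeasurableSet A ∧ μ A ≠ 0 ∧ μ A ≠ 1

end MeasFlow

/-! Weak mixing passes to countable products (`IsWeaklyMixing.pi`) and to factors, so the product of
the `T i`, and through the inverse of `Φ` also the product of the `S i`, is weakly mixing. Fix `j`
and regard the coordinate `Φ y j` as a factor map from the product of the `S i` to `T j`.

Split the index set into `A` and its complement. The joint law of `Φ y j` and the two blocks of `y`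
is an ergodic joining of `T j` with two weakly mixing flows, so by JP one block is independent of
the pair formed by `Φ y j` and the other block. Since `Φ y j` is a function of both blocks, freezing
the independent block at a generic value shows that it is a function of the other block alone
(`HasJP.essDependsOn_or_compl`).

Apply this to tails of `ℕ`. If every tail determines `Φ y j`, then it is almost surely constant by
Kolmogorov's zero-one law. Otherwise let `n + 1` be the first tail that fails: `Φ y j` is determined
by the coordinates up to `n` and also by those from `n` on, hence by their intersection, the single
coordinate `n` (`EssDependsOn.inter`, `HasJP.exists_ae_eq_comp_eval`).

Thus `Φ y j` is a function of `y (a j)` for some map `a`, and the required sets are the fibres of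
`a`. Since `y i` is a function of `Φ y`, freezing the other coordinates of `y` recovers `y i` from
the coordinates of `Φ y` in the fibre over `i` (`exists_leftInverse_of_ae_eq_eval`). If the `S i`
have JP too, the inverse of `Φ` yields a map `b` in the same way, and nontriviality forces `a` and
`b` to be mutually inverse. -/

namespace MeasFlow

/-! ### Correlations of sets and continuity of flows -/

section Correlation

variable {X : Type*} [MeasurableSpace X] {T : ℝ → X → X} {μ : Measure X}

/-- The correlation of `A` with `T^{-t} B`, as a function of the time `t`. -/
noncomputable def corr (T : ℝ → X → X) (μ : Measure X) (A B : Set X) (t : ℝ) : ℝ :=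
  μ.real (A ∩ T t ⁻¹' B) - μ.real A * μ.real B

lemma IsFlow.continuous_measureReal [IsFiniteMeasure μ] (h : IsFlow T μ) {A B : Set X}
    (hA : MeasurableSet A) (hB : MeasurableSet B) :
    Continuous fun t => μ.real (A ∩ T t ⁻¹' B) := by
  have key := h.continuous_inner (B.indicator fun _ => 1) (A.indicator fun _ => 1)
    (memLp_indicator_const 2 hB 1 (.inr (measure_ne_top _ _)))
    (memLp_indicator_const 2 hA 1 (.inr (measure_ne_top _ _)))
  have eq : ∀ t, ∫ x, B.indicator (fun _ => (1 : ℂ)) (T t x) *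
      (starRingEnd ℂ) (A.indicator (fun _ => (1 : ℂ)) x) ∂μ = (μ.real (A ∩ T t ⁻¹' B) : ℂ) := by
    intro t
    have hm : MeasurableSet (A ∩ T t ⁻¹' B) := hA.inter ((h.measurePreserving t).measurable hB)
    have : (fun x => B.indicator (fun _ => (1 : ℂ)) (T t x) *
        (starRingEnd ℂ) (A.indicator (fun _ => (1 : ℂ)) x)) =
        (A ∩ T t ⁻¹' B).indicator fun _ => (1 : ℂ) := by
      ext x
      by_cases h1 : x ∈ A <;> by_cases h2 : T t x ∈ B <;> simp [h1, h2]
    rw [this, integral_indicator_const _ hm]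
    simp
  simp only [eq] at key
  exact Complex.continuous_re.comp key

lemma IsFlow.continuous_corr [IsFiniteMeasure μ] (h : IsFlow T μ) {A B : Set X}
    (hA : MeasurableSet A) (hB : MeasurableSet B) : Continuous (corr T μ A B) :=
  (h.continuous_measureReal hA hB).sub continuous_const

/-- Continuity of matrix coefficients can be tested on indicators of measurable sets. -/
theorem IsFlow.of_continuous_measureReal [IsFiniteMeasure μ]
    (hmp : ∀ t, MeasurePreserving (T t) μ μ) (zero : T 0 =ᵐ[μ] id)
    (add : ∀ s t, T (s + t) =ᵐ[μ] T s ∘ T t)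
    (hc : ∀ A B, MeasurableSet A → MeasurableSet B →
      Continuous fun t => μ.real (A ∩ T t ⁻¹' B)) : IsFlow T μ := by
  refine ⟨hmp, zero, add, fun f g hf hg => ?_⟩
  let U : ℝ → Lp ℂ 2 μ →ₗᵢ[ℂ] Lp ℂ 2 μ := fun t => Lp.compMeasurePreservingₗᵢ ℂ (T t) (hmp t)
  have main : ∀ f g : Lp ℂ 2 μ, Continuous fun t => inner ℂ g (U t f) := by
    have closed_right : ∀ g : Lp ℂ 2 μ,
        IsClosed {f : Lp ℂ 2 μ | Continuous fun t => inner ℂ g (U t f)} := by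
      intro g
      refine isClosed_of_closure_subset fun f hf => ?_
      refine continuous_of_uniform_approx_of_continuous fun u hu => ?_
      obtain ⟨ε, hε, hεu⟩ := Metric.mem_uniformity_dist.1 hu
      obtain ⟨f', hf', hd⟩ := Metric.mem_closure_iff.1 hf (ε / (‖g‖ + 1)) (by positivity)
      refine ⟨_, hf', fun t => hεu ?_⟩
      rw [dist_eq_norm, ← inner_sub_right, ← map_sub]
      calc ‖inner ℂ g (U t (f - f'))‖ ≤ ‖g‖ * ‖U t (f - f')‖ := norm_inner_le_norm _ _
        _ = ‖g‖ * dist f f' := by rw [LinearIsometry.norm_map, dist_eq_norm]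
        _ ≤ ‖g‖ * (ε / (‖g‖ + 1)) := by gcongr
        _ < ε := by
          rw [mul_div_assoc', div_lt_iff₀ (by positivity)]
          nlinarith [norm_nonneg g]
    have closed_left : ∀ f : Lp ℂ 2 μ,
        IsClosed {g : Lp ℂ 2 μ | Continuous fun t => inner ℂ g (U t f)} := by
      intro f
      refine isClosed_of_closure_subset fun g hg => ?_
      refine continuous_of_uniform_approx_of_continuous fun u hu => ?_
      obtain ⟨ε, hε, hεu⟩ := Metric.mem_uniformity_dist.1 hu
      obtain ⟨g', hg', hd⟩ := Metric.mem_closure_iff.1 hg (ε / (‖f‖ + 1)) (by positivity)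
      refine ⟨_, hg', fun t => hεu ?_⟩
      rw [dist_eq_norm, ← inner_sub_left]
      calc ‖inner ℂ (g - g') (U t f)‖ ≤ ‖g - g'‖ * ‖U t f‖ := norm_inner_le_norm _ _
        _ = dist g g' * ‖f‖ := by rw [LinearIsometry.norm_map, dist_eq_norm]
        _ ≤ (ε / (‖f‖ + 1)) * ‖f‖ := by gcongr
        _ < ε := by
          rw [div_mul_eq_mul_div, div_lt_iff₀ (by positivity)]
          nlinarith [norm_nonneg f]
    intro f g
    induction f using Lp.induction (p := 2) ENNReal.ofNat_ne_top with
    | indicatorConst c hB hμB =>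
      rename_i B
      induction g using Lp.induction (p := 2) ENNReal.ofNat_ne_top with
      | indicatorConst d hA hμA =>
        rename_i A
        have eq : ∀ t, inner ℂ (Lp.simpleFunc.indicatorConst 2 hA hμA.ne d : Lp ℂ 2 μ)
            (U t (Lp.simpleFunc.indicatorConst 2 hB hμB.ne c : Lp ℂ 2 μ)) =
            (μ.real (A ∩ T t ⁻¹' B) : ℂ) * (c * (starRingEnd ℂ) d) := by
          intro t
          have hB' := (hmp t).measurable hB
          have e2 : U t (indicatorConstLp 2 hB hμB.ne c) =
              indicatorConstLp 2 hB' (measure_ne_top μ _) c :=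
            Lp.indicatorConstLp_compMeasurePreserving (p := 2) hB hμB.ne c (hmp t)
          rw [Lp.simpleFunc.coe_indicatorConst, Lp.simpleFunc.coe_indicatorConst, e2,
            L2.inner_indicatorConstLp_eq_setIntegral_inner]
          have : ∫ x in A, inner ℂ d ((indicatorConstLp 2 hB'
              (measure_ne_top μ _) c : Lp ℂ 2 μ) x) ∂μ =
              ∫ x in A, (T t ⁻¹' B).indicator (fun _ => inner ℂ d c) x ∂μ := by
            refine integral_congr_ae (ae_restrict_of_ae ?_)
            filter_upwards [indicatorConstLp_coeFn (p := 2) (hs := hB')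
              (hμs := measure_ne_top μ _) (c := c)] with x hx
            rw [hx]
            by_cases h : x ∈ T t ⁻¹' B <;> simp [h]
          rw [this, integral_indicator_const _ hB', measureReal_restrict_apply hB', Set.inter_comm]
          simp
        simp only [eq]
        exact (Complex.continuous_ofReal.comp (hc A B hA hB)).mul continuous_const
      | add hf hg _ h1 h2 => simp only [inner_add_left]; exact h1.add h2
      | isClosed => exact closed_left _
    | add hf hg _ h1 h2 => simp only [map_add, inner_add_right]; exact h1.add h2
    | isClosed => exact closed_right g
  have := main hf.toLp hg.toLp
  convert this using 2 with t
  rw [L2.inner_def]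
  refine integral_congr_ae ?_
  filter_upwards [hg.coeFn_toLp, Lp.coeFn_compMeasurePreserving hf.toLp (hmp t),
    (hmp t).quasiMeasurePreserving.ae hf.coeFn_toLp] with x h1 h2 h3
  have h2' : (U t hf.toLp) x = (hf.toLp) (T t x) := h2
  rw [h1, h2', h3]
  simp

/-- To prove that all correlations belong to a class of functions which is closed under dominated
series, it suffices to consider sets in a generating `π`-system. -/
theorem corr_mem_of_generateFrom [IsProbabilityMeasure μ]
    (hmp : ∀ t, MeasurePreserving (T t) μ μ) (K : Set (ℝ → ℝ)) (h0 : 0 ∈ K)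
    (hneg : ∀ f ∈ K, -f ∈ K)
    (hsum : ∀ (f : ℕ → ℝ → ℝ) (v : ℕ → ℝ), Summable v → (∀ n t, |f n t| ≤ v n) →
      (∀ n, f n ∈ K) → (fun t => ∑' n, f n t) ∈ K)
    {C : Set (Set X)} (hgen : ‹MeasurableSpace X› = MeasurableSpace.generateFrom C)
    (hpi : IsPiSystem C) (hC : ∀ A ∈ C, ∀ B ∈ C, corr T μ A B ∈ K) {A B : Set X}
    (hA : MeasurableSet A) (hB : MeasurableSet B) : corr T μ A B ∈ K := by
  have hreal : ∀ t (B : Set X), MeasurableSet B → μ.real (T t ⁻¹' B) = μ.real B := fun t B hB =>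
    by rw [measureReal_def, (hmp t).measure_preimage hB.nullMeasurableSet, measureReal_def]
  have hbound : ∀ A B t, MeasurableSet A → MeasurableSet B →
      |corr T μ A B t| ≤ μ.real A ∧ |corr T μ A B t| ≤ μ.real B := by
    intro A B t hA hB
    have h1 : μ.real (A ∩ T t ⁻¹' B) ≤ μ.real A := measureReal_mono Set.inter_subset_left
    have h2 : μ.real (A ∩ T t ⁻¹' B) ≤ μ.real B :=
      (measureReal_mono Set.inter_subset_right).trans_eq (hreal t B hB)
    have h3 := measureReal_le_one (μ := μ) (s := A)
    have h4 := measureReal_le_one (μ := μ) (s := B)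
    have h5 : 0 ≤ μ.real A := measureReal_nonneg
    have h6 : 0 ≤ μ.real B := measureReal_nonneg
    have h7 : 0 ≤ μ.real (A ∩ T t ⁻¹' B) := measureReal_nonneg
    unfold corr
    constructor <;> rw [abs_le] <;> constructor <;> nlinarith
  have hsummable : ∀ f : ℕ → Set X, Pairwise (Function.onFun Disjoint f) →
      (∀ i, MeasurableSet (f i)) → HasSum (fun i => μ.real (f i)) (μ.real (⋃ i, f i)) :=
    fun f hd hm => by
      have h := measure_iUnion (μ := μ) hd hm
      have h' : ∑' i, μ (f i) ≠ ⊤ := h ▸ measure_ne_top μ _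
      have := ENNReal.hasSum_toReal h'
      rwa [← ENNReal.tsum_toReal_eq fun i => measure_ne_top μ _, ← h] at this
  -- Two Dynkin arguments: the first set is made arbitrary while the second stays in `C`, then the
  -- second set is freed.
  have step : ∀ A, MeasurableSet A → ∀ B ∈ C, corr T μ A B ∈ K := by
    intro A hA B hBC
    have hB : MeasurableSet B := hgen ▸ MeasurableSpace.measurableSet_generateFrom hBC
    induction A, hA using MeasurableSpace.induction_on_inter hgen hpi with
    | empty => convert h0; ext t; simp [corr]
    | basic A hAC => exact hC A hAC B hBC
    | compl A hA ih =>
      convert hneg _ ih using 1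
      ext t
      have h1 : μ.real (Aᶜ ∩ T t ⁻¹' B) = μ.real B - μ.real (A ∩ T t ⁻¹' B) := by
        rw [← hreal t B hB, ← measureReal_inter_add_sdiff hA (s := T t ⁻¹' B), Set.inter_comm Aᶜ,
          Set.inter_comm A, Set.sdiff_eq]
        ring
      simp only [corr, h1, Pi.neg_apply, probReal_compl_eq_one_sub hA]
      ring
    | iUnion f hd hf ih =>
      convert hsum (fun n => corr T μ (f n) B) (fun n => μ.real (f n)) (hsummable f hd hf).summable
        (fun n t => (hbound _ _ t (hf n) hB).1) ih using 1
      ext t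
      have h1 := hsummable (fun n => f n ∩ T t ⁻¹' B)
        (fun i j hij => (hd hij).mono Set.inter_subset_left Set.inter_subset_left)
        (fun n => (hf n).inter ((hmp t).measurable hB))
      rw [← Set.iUnion_inter] at h1
      exact (h1.sub ((hsummable f hd hf).mul_right _)).tsum_eq.symm
  induction B, hB using MeasurableSpace.induction_on_inter hgen hpi with
  | empty => convert h0; ext t; simp [corr]
  | basic B hBC => exact step A hA B hBC
  | compl B hB ih =>
    convert hneg _ ih using 1
    ext t
    have h1 : μ.real (A ∩ T t ⁻¹' Bᶜ) = μ.real A - μ.real (A ∩ T t ⁻¹' B) := by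
      rw [← measureReal_inter_add_sdiff ((hmp t).measurable hB) (s := A), Set.preimage_compl,
        Set.sdiff_eq]
      ring
    simp only [corr, h1, Pi.neg_apply, probReal_compl_eq_one_sub hB]
    ring
  | iUnion f hd hf ih =>
    convert hsum (fun n => corr T μ A (f n)) (fun n => μ.real (f n)) (hsummable f hd hf).summable
      (fun n t => (hbound _ _ t hA (hf n)).2) ih using 1
    ext t
    have h1 := hsummable (fun n => A ∩ T t ⁻¹' (f n))
      (fun i j hij => ((hd hij).preimage _).mono Set.inter_subset_right Set.inter_subset_right)
      (fun n => hA.inter ((hmp t).measurable (hf n)))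
    rw [← Set.inter_iUnion, ← Set.preimage_iUnion] at h1
    exact (h1.sub ((hsummable f hd hf).mul_left _)).tsum_eq.symm

end Correlation

/-! ### Functions that vanish in absolute Cesàro mean -/

section CesaroNull

/-- Continuous functions whose absolute values have Cesàro means tending to `0`. -/
def cesaroNull : Set (ℝ → ℝ) :=
  {f | Continuous f ∧ Tendsto (fun R : ℝ => R⁻¹ * ∫ t in (0 : ℝ)..R, |f t|) atTop (𝓝 0)}

/-- The slack `ε` gives closure under uniform approximation, which is what absorbs the tails of
series. -/
lemma cesaroNull_of_abs_le {f : ℝ → ℝ} (hf : Continuous f)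
    (h : ∀ ε > 0, ∃ g ∈ cesaroNull, ∀ t, |f t| ≤ |g t| + ε) : f ∈ cesaroNull := by
  refine ⟨hf, ?_⟩
  rw [Metric.tendsto_atTop]
  intro ε hε
  obtain ⟨g, ⟨hgc, hg⟩, hfg⟩ := h (ε / 2) (by positivity)
  obtain ⟨N, hN⟩ := Metric.tendsto_atTop.1 hg (ε / 2) (by positivity)
  refine ⟨max N 1, fun R hR => ?_⟩
  have hR1 : 0 < R := lt_of_lt_of_le one_pos ((le_max_right _ _).trans hR)
  have h1 := hN R ((le_max_left _ _).trans hR)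
  simp only [Real.dist_eq, sub_zero] at h1 ⊢
  have h2 : ∫ t in (0 : ℝ)..R, |f t| ≤ (∫ t in (0 : ℝ)..R, |g t|) + R * (ε / 2) := by
    calc ∫ t in (0 : ℝ)..R, |f t| ≤ ∫ t in (0 : ℝ)..R, (|g t| + ε / 2) :=
          intervalIntegral.integral_mono hR1.le (hf.abs.intervalIntegrable _ _)
            ((hgc.abs.add continuous_const).intervalIntegrable _ _) hfg
      _ = _ := by
          rw [intervalIntegral.integral_add (hgc.abs.intervalIntegrable _ _)
            (continuous_const.intervalIntegrable _ _)]
          simp [mul_div_assoc]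
  have h3 : 0 ≤ ∫ t in (0 : ℝ)..R, |f t| :=
    intervalIntegral.integral_nonneg hR1.le fun _ _ => abs_nonneg _
  rw [abs_of_nonneg (by positivity)]
  calc R⁻¹ * ∫ t in (0 : ℝ)..R, |f t|
      ≤ R⁻¹ * ((∫ t in (0 : ℝ)..R, |g t|) + R * (ε / 2)) := by gcongr
    _ = R⁻¹ * (∫ t in (0 : ℝ)..R, |g t|) + ε / 2 := by field_simp
    _ < ε / 2 + ε / 2 := by gcongr; exact (abs_lt.1 h1).2
    _ = ε := by ring

lemma cesaroNull_of_abs_le_abs {f g : ℝ → ℝ} (hf : Continuous f) (hg : g ∈ cesaroNull)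
    (h : ∀ t, |f t| ≤ |g t|) : f ∈ cesaroNull :=
  cesaroNull_of_abs_le hf fun ε hε => ⟨g, hg, fun t => (h t).trans (by linarith)⟩

lemma zero_mem_cesaroNull : (0 : ℝ → ℝ) ∈ cesaroNull := ⟨continuous_zero, by simp⟩

lemma neg_mem_cesaroNull {f : ℝ → ℝ} (hf : f ∈ cesaroNull) : -f ∈ cesaroNull :=
  ⟨hf.1.neg, by simpa using hf.2⟩

lemma abs_mem_cesaroNull {f : ℝ → ℝ} (hf : f ∈ cesaroNull) : (fun t => |f t|) ∈ cesaroNull :=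
  ⟨hf.1.abs, by simpa using hf.2⟩

lemma add_mem_cesaroNull {f g : ℝ → ℝ} (hf : f ∈ cesaroNull) (hg : g ∈ cesaroNull) :
    f + g ∈ cesaroNull := by
  have h : (fun t => |f t| + |g t|) ∈ cesaroNull := by
    refine ⟨hf.1.abs.add hg.1.abs, ?_⟩
    convert hf.2.add hg.2 using 2 with R
    · rw [← mul_add, ← intervalIntegral.integral_add (hf.1.abs.intervalIntegrable _ _)
        (hg.1.abs.intervalIntegrable _ _)]
      congr 2
      ext t
      exact abs_of_nonneg (by positivity)
    · simp
  exact cesaroNull_of_abs_le_abs (hf.1.add hg.1) h fun t =>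
    (abs_add_le _ _).trans (le_abs_self _)

lemma sum_mem_cesaroNull {ι : Type*} {f : ι → ℝ → ℝ} (s : Finset ι)
    (hf : ∀ i ∈ s, f i ∈ cesaroNull) : (fun t => ∑ i ∈ s, f i t) ∈ cesaroNull := by
  classical
  induction s using Finset.induction_on with
  | empty => exact zero_mem_cesaroNull
  | insert a s ha ih =>
    simp only [Finset.sum_insert ha]
    exact add_mem_cesaroNull (hf a (by simp)) (ih fun i hi => hf i (by simp [hi]))

/-- Domination makes the tails small uniformly in `t`, so a finite partial sum is within `ε` of the
series. -/
lemma tsum_mem_cesaroNull (f : ℕ → ℝ → ℝ) (v : ℕ → ℝ) (hv : Summable v)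
    (hfv : ∀ n t, |f n t| ≤ v n) (hf : ∀ n, f n ∈ cesaroNull) :
    (fun t => ∑' n, f n t) ∈ cesaroNull := by
  refine cesaroNull_of_abs_le (continuous_tsum (fun n => (hf n).1) hv hfv) fun ε hε => ?_
  have htail := tendsto_sum_nat_add v
  obtain ⟨N, hN⟩ := (htail.eventually (gt_mem_nhds hε)).exists
  refine ⟨_, sum_mem_cesaroNull (Finset.range N) fun n _ => hf n, fun t => ?_⟩
  have hs : Summable fun n => f n t := .of_norm_bounded hv fun n => hfv n t
  rw [← hs.sum_add_tsum_nat_add N]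
  refine (abs_add_le _ _).trans (add_le_add le_rfl ?_)
  have hv' : Summable fun n => v (n + N) := (summable_nat_add_iff N).2 hv
  calc |∑' n, f (n + N) t| ≤ ∑' n, v (n + N) :=
        tsum_of_norm_bounded (f := fun n => f (n + N) t) hv'.hasSum fun n => hfv (n + N) t
    _ ≤ ε := hN.le

end CesaroNull

/-! ### Weak mixing implies ergodicity -/

section WeakMixing

variable {X : Type*} [MeasurableSpace X] {T : ℝ → X → X} {μ : Measure X} [IsProbabilityMeasure μ]

lemma IsWeaklyMixing.corr_mem (hT : IsFlow T μ) (h : IsWeaklyMixing T μ) {A B : Set X}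
    (hA : MeasurableSet A) (hB : MeasurableSet B) : corr T μ A B ∈ cesaroNull :=
  ⟨hT.continuous_corr hA hB, h A B hA hB⟩

/-- The autocorrelation of an invariant set of measure `m` is the constant `m - m²`, which equals
its own Cesàro mean and so must vanish. -/
theorem IsWeaklyMixing.isErgodic (h : IsWeaklyMixing T μ) : IsErgodic T μ := by
  intro A hA hinv
  have h1 : ∀ t, μ.real (A ∩ T t ⁻¹' A) = μ.real A := fun t => by
    refine measureReal_congr ?_
    refine eventuallyEq_set.2 ?_
    filter_upwards [(hinv t).mem_iff] with x hx
    simp [hx]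
  have h2 := h A A hA hA
  simp only [h1, intervalIntegral.integral_const, sub_zero, smul_eq_mul] at h2
  have h3 : Tendsto (fun _ : ℝ => |μ.real A - μ.real A * μ.real A|) atTop (𝓝 0) := by
    refine h2.congr' ?_
    filter_upwards [eventually_ne_atTop 0] with R hR
    field_simp
  have h4 := tendsto_nhds_unique h3 tendsto_const_nhds
  have h5 : μ.real A * (1 - μ.real A) = 0 := by linarith [abs_eq_zero.1 h4.symm]
  rcases mul_eq_zero.1 h5 with h | h
  · left; simpa [measureReal_def, ENNReal.toReal_eq_zero_iff] using h
  · right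
    have : μ.real A = 1 := by linarith
    rwa [measureReal_def, ENNReal.toReal_eq_one_iff] at this

end WeakMixing

/-! ### Properties inherited by factors -/

section Factor

variable {X Y : Type*} [MeasurableSpace X] [MeasurableSpace Y] {S : ℝ → Y → Y} {ν : Measure Y}
  {T : ℝ → X → X} {μ : Measure X} {φ : Y → X}

lemma IsErgodic.of_factor (h : IsErgodic S ν) (hφ : MeasurePreserving φ ν μ)
    (heq : ∀ t, φ ∘ S t =ᵐ[ν] T t ∘ φ) : IsErgodic T μ := by
  intro A hA hinv
  rw [← hφ.measure_preimage hA.nullMeasurableSet]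
  refine h _ (hφ.measurable hA) fun t => ?_
  have h1 : T t ∘ φ ⁻¹' A =ᵐ[ν] φ ⁻¹' A := hφ.quasiMeasurePreserving.preimage_ae_eq (hinv t)
  refine EventuallyEq.trans ?_ h1
  refine eventuallyEq_set.2 ?_
  filter_upwards [heq t] with y hy
  exact iff_of_eq (congrArg (· ∈ A) hy)

lemma IsWeaklyMixing.of_factor (h : IsWeaklyMixing S ν) (hT : ∀ t, Measurable (T t))
    (hφ : MeasurePreserving φ ν μ)
    (heq : ∀ t, φ ∘ S t =ᵐ[ν] T t ∘ φ) : IsWeaklyMixing T μ := by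
  intro A B hA hB
  have hm : ∀ C, MeasurableSet C → μ.real C = ν.real (φ ⁻¹' C) := fun C hC => by
    rw [measureReal_def, measureReal_def, hφ.measure_preimage hC.nullMeasurableSet]
  convert h (φ ⁻¹' A) (φ ⁻¹' B) (hφ.measurable hA) (hφ.measurable hB) using 7 with R t
  · rw [hm _ (hA.inter (hT t hB))]
    refine measureReal_congr ?_
    refine eventuallyEq_set.2 ?_
    filter_upwards [heq t] with y hy
    have hy' : φ (S t y) = T t (φ y) := hy
    simp [hy']
  · rw [hm A hA, hm B hB]

lemma invariant_of_factor (hS : ∀ t, MeasurePreserving (S t) ν ν)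
    (hT : ∀ t, Measurable (T t)) (hφ : MeasurePreserving φ ν μ)
    (heq : ∀ t, φ ∘ S t =ᵐ[ν] T t ∘ φ) (t : ℝ) : μ.map (T t) = μ := by
  rw [← hφ.map_eq, Measure.map_map (hT t) hφ.measurable, ← Measure.map_congr (heq t),
    ← Measure.map_map hφ.measurable (hS t).measurable, (hS t).map_eq]

end Factor

/-! ### Countable products of flows -/

section Pi

variable {ι : Type*} {X : ι → Type*} [∀ i, MeasurableSpace (X i)]
  {μ : ∀ i, Measure (X i)} [∀ i, IsProbabilityMeasure (μ i)] {T : ∀ i, ℝ → X i → X i}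

lemma measurePreserving_piFlow (h : ∀ i, IsFlow (T i) (μ i)) (t : ℝ) :
    MeasurePreserving (piFlow T t) (Measure.infinitePi μ) (Measure.infinitePi μ) := by
  have hm : ∀ i, Measurable (T i t) := fun i => ((h i).measurePreserving t).measurable
  refine ⟨by unfold piFlow; fun_prop, ?_⟩
  unfold piFlow
  rw [Measure.infinitePi_map_pi μ hm]
  congr 1
  ext1 i
  exact ((h i).measurePreserving t).map_eq

/-- Padding with `Set.univ` lets two cylinders be written over a common finite set of coordinates.
-/
lemma squareCylinder_eq_of_subset (s s' : Finset ι) (hs : s ⊆ s') (a : ∀ i, Set (X i))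
    (ha : ∀ i, MeasurableSet (a i)) : ∃ a' : ∀ i, Set (X i), (∀ i, MeasurableSet (a' i)) ∧
      (s : Set ι).pi a = (s' : Set ι).pi a' := by
  classical
  refine ⟨fun i => if i ∈ s then a i else Set.univ, fun i => ?_, ?_⟩
  · dsimp only
    split_ifs
    exacts [ha i, .univ]
  · ext x
    simp only [Set.mem_pi, Finset.mem_coe]
    refine ⟨fun h i _ => ?_, fun h i hi => ?_⟩
    · split_ifs with hi
      exacts [h i hi, trivial]
    · simpa [hi] using h i (hs hi)

/-- The correlation of two boxes with the same finite set of constrained coordinates. -/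
lemma corr_piFlow_box (h : ∀ i, IsFlow (T i) (μ i)) (s : Finset ι) {a b : ∀ i, Set (X i)}
    (ha : ∀ i, MeasurableSet (a i)) (hb : ∀ i, MeasurableSet (b i)) (t : ℝ) :
    corr (piFlow T) (Measure.infinitePi μ) ((s : Set ι).pi a) ((s : Set ι).pi b) t =
      ∏ i ∈ s, (μ i).real (a i ∩ T i t ⁻¹' (b i)) -
        ∏ i ∈ s, ((μ i).real (a i) * (μ i).real (b i)) := by
  have h1 : (s : Set ι).pi a ∩ piFlow T t ⁻¹' (s : Set ι).pi b =
      (s : Set ι).pi fun i => a i ∩ T i t ⁻¹' (b i) := by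
    ext x
    simp only [Set.mem_inter_iff, Set.mem_pi, Set.mem_preimage, piFlow]
    grind
  rw [corr, h1, measureReal_def, measureReal_def, measureReal_def,
    Measure.infinitePi_pi _ (fun i _ => ha i), Measure.infinitePi_pi _ (fun i _ => hb i),
    Measure.infinitePi_pi _ (fun i _ => (ha i).inter (((h i).measurePreserving t).measurable (hb i)))]
  simp only [ENNReal.toReal_prod, Finset.prod_mul_distrib, measureReal_def]

/-- Common source of continuity and weak mixing of the product, with `K` the continuous functions
and `cesaroNull` respectively: boxes form a generating `π`-system. -/
lemma corr_piFlow_mem [Countable ι] (h : ∀ i, IsFlow (T i) (μ i)) (K : Set (ℝ → ℝ)) (h0 : 0 ∈ K)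
    (hneg : ∀ f ∈ K, -f ∈ K)
    (hsum : ∀ (f : ℕ → ℝ → ℝ) (v : ℕ → ℝ), Summable v → (∀ n t, |f n t| ≤ v n) →
      (∀ n, f n ∈ K) → (fun t => ∑' n, f n t) ∈ K)
    (hbox : ∀ (s : Finset ι) (a b : ∀ i, Set (X i)), (∀ i, MeasurableSet (a i)) →
      (∀ i, MeasurableSet (b i)) →
      (fun t => ∏ i ∈ s, (μ i).real (a i ∩ T i t ⁻¹' (b i)) -
        ∏ i ∈ s, ((μ i).real (a i) * (μ i).real (b i))) ∈ K)
    {A B : Set (∀ i, X i)} (hA : MeasurableSet A) (hB : MeasurableSet B) :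
    corr (piFlow T) (Measure.infinitePi μ) A B ∈ K := by
  classical
  refine corr_mem_of_generateFrom (measurePreserving_piFlow h) K h0 hneg hsum
    generateFrom_squareCylinders.symm
    (isPiSystem_squareCylinders (fun i => MeasurableSpace.isPiSystem_measurableSet)
      fun i => MeasurableSet.univ) ?_ hA hB
  rintro _ ⟨s, a, ha, rfl⟩ _ ⟨s', b, hb, rfl⟩
  obtain ⟨a', ha', ea⟩ := squareCylinder_eq_of_subset s (s ∪ s') Finset.subset_union_left a
    fun i => ha i trivial
  obtain ⟨b', hb', eb⟩ := squareCylinder_eq_of_subset s' (s ∪ s') Finset.subset_union_right b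
    fun i => hb i trivial
  rw [ea, eb]
  convert hbox (s ∪ s') a' b' ha' hb' using 1
  ext t
  exact corr_piFlow_box h _ ha' hb' t

theorem IsFlow.pi [Countable ι] (h : ∀ i, IsFlow (T i) (μ i)) : IsFlow (piFlow T) (Measure.infinitePi μ) := by
  refine .of_continuous_measureReal (measurePreserving_piFlow h) ?_ (fun s t => ?_) ?_
  · have : ∀ᵐ x ∂Measure.infinitePi μ, ∀ i, T i 0 (x i) = x i := ae_all_iff.2 fun i =>
      (measurePreserving_eval_infinitePi μ i).quasiMeasurePreserving.ae (h i).zero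
    filter_upwards [this] with x hx
    exact funext hx
  · have : ∀ᵐ x ∂Measure.infinitePi μ, ∀ i, T i (s + t) (x i) = T i s (T i t (x i)) :=
      ae_all_iff.2 fun i =>
        (measurePreserving_eval_infinitePi μ i).quasiMeasurePreserving.ae ((h i).add s t)
    filter_upwards [this] with x hx
    exact funext hx
  · intro A B hA hB
    have := corr_piFlow_mem h {f | Continuous f} continuous_zero (fun f hf => hf.neg)
      (fun f v hv hfv hf => continuous_tsum hf hv hfv) ?_ hA hB
    · have h2 := Continuous.add this (continuous_const
        (y := (Measure.infinitePi μ).real A * (Measure.infinitePi μ).real B))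
      convert h2 using 2 with t
      simp [corr]
    · intro s a b ha hb
      exact (continuous_finsetProd s fun i _ =>
        (h i).continuous_measureReal (ha i) (hb i)).sub continuous_const

theorem IsWeaklyMixing.pi [Countable ι] (h : ∀ i, IsFlow (T i) (μ i)) (hw : ∀ i, IsWeaklyMixing (T i) (μ i)) :
    IsWeaklyMixing (piFlow T) (Measure.infinitePi μ) := by
  intro A B hA hB
  refine (corr_piFlow_mem h cesaroNull zero_mem_cesaroNull (fun f hf => neg_mem_cesaroNull hf)
    tsum_mem_cesaroNull (fun s a b ha hb => ?_) hA hB).2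
  refine cesaroNull_of_abs_le_abs ((continuous_finsetProd s fun i _ =>
        (h i).continuous_measureReal (ha i) (hb i)).sub continuous_const)
    (sum_mem_cesaroNull s fun i _ => abs_mem_cesaroNull ((hw i).corr_mem (h i) (ha i) (hb i)))
    fun t => ?_
  refine le_trans ?_ (le_abs_self _)
  classical
  induction s using Finset.induction_on with
  | empty => simp
  | insert j s hj ih =>
    rw [Finset.prod_insert hj, Finset.prod_insert hj, Finset.sum_insert hj]
    set p := ∏ i ∈ s, (μ i).real (a i ∩ T i t ⁻¹' (b i))
    set q := ∏ i ∈ s, ((μ i).real (a i) * (μ i).real (b i))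
    have hp0 : 0 ≤ p := Finset.prod_nonneg fun i _ => measureReal_nonneg
    have hp1 : p ≤ 1 := Finset.prod_le_one (fun i _ => measureReal_nonneg)
      fun i _ => measureReal_le_one
    have hc1 : |(μ j).real (a j) * (μ j).real (b j)| ≤ 1 := by
      rw [abs_of_nonneg (by positivity)]
      exact mul_le_one₀ measureReal_le_one measureReal_nonneg measureReal_le_one
    -- Telescoping: exchanging one factor costs the correlation in that coordinate, since all other
    -- factors are at most `1`.
    calc |(μ j).real (a j ∩ T j t ⁻¹' (b j)) * p - (μ j).real (a j) * (μ j).real (b j) * q|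
        = |corr (T j) (μ j) (a j) (b j) t * p +
            (μ j).real (a j) * (μ j).real (b j) * (p - q)| := by unfold corr; ring_nf
      _ ≤ |corr (T j) (μ j) (a j) (b j) t| * p +
            |(μ j).real (a j) * (μ j).real (b j)| * |p - q| := by
          refine (abs_add_le _ _).trans_eq ?_
          rw [abs_mul, abs_mul, abs_of_nonneg hp0]
      _ ≤ _ := by
          refine add_le_add (mul_le_of_le_one_right (abs_nonneg _) hp1) ?_
          exact (mul_le_of_le_one_left (abs_nonneg _) hc1).trans ih

end Pi

/-! ### Freezing an independent variable -/

section AlmostEverywhere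

variable {X Y : Type*} [MeasurableSpace X] [MeasurableSpace Y] {μ : Measure X} {ν : Measure Y}

lemma ae_of_ae_comp {φ : Y → X} (hφ : MeasurePreserving φ ν μ) {P : X → Prop}
    (hP : MeasurableSet {x | P x}) (h : ∀ᵐ y ∂ν, P (φ y)) : ∀ᵐ x ∂μ, P x := by
  rw [← hφ.map_eq]
  exact (ae_map_iff hφ.measurable.aemeasurable hP).2 h

/-- Fubini. This is the tool that later eliminates independent coordinates by fixing them at a
generic value. -/
lemma exists_ae_of_ae_prod [SFinite μ] [SFinite ν] [NeZero ν] {P : X × Y → Prop}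
    (h : ∀ᵐ p ∂(μ.prod ν), P p) : ∃ y, ∀ᵐ x ∂μ, P (x, y) := by
  have h1 : ∀ᵐ q ∂(ν.prod μ), P q.swap :=
    Measure.measurePreserving_swap.quasiMeasurePreserving.ae h
  exact (Measure.ae_ae_of_ae_prod h1).exists

lemma not_isNontrivial_of_ae_eq_const [IsProbabilityMeasure μ] {c : X} (h : ∀ᵐ x ∂μ, x = c) :
    ¬ IsNontrivial μ := by
  rintro ⟨A, hA, h0, h1⟩
  by_cases hc : c ∈ A
  · exact h1 ((mem_ae_iff_prob_eq_one hA).1 (h.mono fun x hx => hx ▸ hc))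
  · exact h0 (measure_eq_zero_iff_ae_notMem.2 (h.mono fun x hx => hx ▸ hc))

/-- If a random point `x` is a function of `(a, b)`, and `b` is independent of `(x, a)`, then `x`
is a function of `a`. -/
lemma exists_ae_eq_of_eq_prod_left {Z : Type*} [MeasurableSpace Z] {ν₂ : Measure Z}
    [IsProbabilityMeasure ν₂]
    {ρ : Measure (X × (Y × Z))} [IsProbabilityMeasure ρ] {F : Y × Z → X}
    (hF : ∀ᵐ p ∂ρ, p.1 = F p.2)
    (h : ρ = ((ρ.map fun p => (p.1, p.2.1)).prod ν₂).map (fun q => (q.1.1, (q.1.2, q.2)))) :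
    ∃ b, ∀ᵐ p ∂ρ, p.1 = F (p.2.1, b) := by
  have : IsProbabilityMeasure (ρ.map fun p => (p.1, p.2.1)) :=
    Measure.isProbabilityMeasure_map (by fun_prop)
  rw [h] at hF
  obtain ⟨b, hb⟩ := exists_ae_of_ae_prod (ae_of_ae_map (by fun_prop) hF)
  exact ⟨b, ae_of_ae_map (by fun_prop) hb⟩

lemma exists_ae_eq_of_eq_prod_right {Z : Type*} [MeasurableSpace Z] {ν₁ : Measure Y}
    [IsProbabilityMeasure ν₁]
    {ρ : Measure (X × (Y × Z))} [IsProbabilityMeasure ρ] {F : Y × Z → X}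
    (hF : ∀ᵐ p ∂ρ, p.1 = F p.2)
    (h : ρ = ((ρ.map fun p => (p.1, p.2.2)).prod ν₁).map (fun q => (q.1.1, (q.2, q.1.2)))) :
    ∃ a, ∀ᵐ p ∂ρ, p.1 = F (a, p.2.2) := by
  have : IsProbabilityMeasure (ρ.map fun p => (p.1, p.2.2)) :=
    Measure.isProbabilityMeasure_map (by fun_prop)
  rw [h] at hF
  obtain ⟨b, hb⟩ := exists_ae_of_ae_prod (ae_of_ae_map (by fun_prop) hF)
  exact ⟨b, ae_of_ae_map (by fun_prop) hb⟩

end AlmostEverywhere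

/-! ### Dependence on a set of coordinates modulo null sets -/

section Piecewise

open scoped Classical

variable {ι : Type*} {Y : ι → Type*} [∀ i, MeasurableSpace (Y i)]

lemma measurable_piecewise_pi (A : Set ι) :
    Measurable fun p : (∀ i, Y i) × (∀ i, Y i) => A.piecewise p.1 p.2 := by
  refine measurable_pi_iff.2 fun i => ?_
  by_cases hi : i ∈ A
  · simp only [Set.piecewise_eq_of_mem _ _ _ hi]; fun_prop
  · simp only [Set.piecewise_eq_of_notMem _ _ _ hi]; fun_prop

variable (ν : ∀ i, Measure (Y i)) [∀ i, IsProbabilityMeasure (ν i)]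

/-- Choosing the coordinates in `A` and those outside `A` from two independent points yields a
point distributed according to the product measure. -/
theorem measurePreserving_piecewise (A : Set ι) :
    MeasurePreserving (fun p : (∀ i, Y i) × (∀ i, Y i) => A.piecewise p.1 p.2)
      ((Measure.infinitePi ν).prod (Measure.infinitePi ν)) (Measure.infinitePi ν) := by
  refine ⟨measurable_piecewise_pi A, Measure.eq_infinitePi _ fun s t ht => ?_⟩
  have h1 : (fun p : (∀ i, Y i) × (∀ i, Y i) => A.piecewise p.1 p.2) ⁻¹' (s : Set ι).pi t =
      ((s.filter (· ∈ A) : Finset ι) : Set ι).pi t ×ˢ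
        ((s.filter (· ∉ A) : Finset ι) : Set ι).pi t := by
    ext p
    simp only [Set.mem_preimage, Set.mem_pi, Set.mem_prod, Finset.coe_filter, Set.piecewise]
    constructor
    · intro h
      refine ⟨fun i hi => ?_, fun i hi => ?_⟩
      · simpa [hi.2] using h i hi.1
      · simpa [hi.2] using h i hi.1
    · rintro ⟨h1, h2⟩ i hi
      split_ifs with hA
      exacts [h1 i ⟨hi, hA⟩, h2 i ⟨hi, hA⟩]
  rw [Measure.map_apply (measurable_piecewise_pi A)
    (MeasurableSet.pi s.countable_toSet fun i _ => ht i), h1, Measure.prod_prod,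
    Measure.infinitePi_pi _ (fun i _ => ht i), Measure.infinitePi_pi _ (fun i _ => ht i),
    Finset.prod_filter_mul_prod_filter_not]

/-- Disjoint blocks of coordinates are independent. -/
lemma infinitePi_inter_of_dependsOn (A : Set ι) {U V : Set (∀ i, Y i)} (hU : MeasurableSet U)
    (hV : MeasurableSet V) (hUA : ∀ y z, A.piecewise y z ∈ U ↔ y ∈ U)
    (hVA : ∀ y z, A.piecewise y z ∈ V ↔ z ∈ V) :
    Measure.infinitePi ν (U ∩ V) = Measure.infinitePi ν U * Measure.infinitePi ν V := by
  rw [← (measurePreserving_piecewise ν A).measure_preimage (hU.inter hV).nullMeasurableSet,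
    ← Measure.prod_prod]
  congr 1
  ext p
  simp [hUA, hVA]

theorem measurePreserving_domRestrict_prod (A : Set ι) :
    MeasurePreserving (fun y : ∀ i, Y i => (A.domRestrict y, (Aᶜ).domRestrict y))
      (Measure.infinitePi ν)
      ((Measure.infinitePi fun i : A => ν i).prod
        (Measure.infinitePi fun i : (Aᶜ : Set ι) => ν i)) := by
  have hm : Measurable (fun y : ∀ i, Y i => (A.domRestrict y, (Aᶜ).domRestrict y)) := by fun_prop
  refine ⟨hm, ?_⟩
  rw [← (measurePreserving_piecewise ν A).map_eq, Measure.map_map hm (measurable_piecewise_pi A),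
    ← Measure.infinitePi_map_restrict', ← Measure.infinitePi_map_restrict',
    Measure.map_prod_map _ _ (by fun_prop) (by fun_prop)]
  congr 1
  ext p i
  · exact Set.piecewise_eq_of_mem _ _ _ i.2
  · exact Set.piecewise_eq_of_notMem _ _ _ i.2

/-- Up to a null set, `f` is a measurable function of the coordinates in `A`. -/
def EssDependsOn {Z : Type*} [MeasurableSpace Z] (f : (∀ i, Y i) → Z) (A : Set ι) : Prop :=
  ∃ h : (∀ i, Y i) → Z, Measurable h ∧ DependsOn h A ∧ f =ᵐ[Measure.infinitePi ν] h

variable {ν} {Z : Type*} [MeasurableSpace Z] {f : (∀ i, Y i) → Z} {A B : Set ι}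

omit [∀ i, IsProbabilityMeasure (ν i)] in
lemma EssDependsOn.mono (h : EssDependsOn ν f A) (hAB : A ⊆ B) : EssDependsOn ν f B := by
  obtain ⟨h, hm, hd, he⟩ := h
  exact ⟨h, hm, hd.mono hAB, he⟩

/-- Let `h` and `k` be versions of `f` depending on `A` and on `B`. Resampling the coordinates
outside `B` leaves `k` unchanged, so `h` at the spliced point still equals `f`; with the new
coordinates frozen, `h` sees only `A ∩ B`. -/
theorem EssDependsOn.inter (hA : EssDependsOn ν f A) (hB : EssDependsOn ν f B) :
    EssDependsOn ν f (A ∩ B) := by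
  obtain ⟨h, hm, hd, he⟩ := hA
  obtain ⟨k, -, kd, ke⟩ := hB
  have h1 : ∀ᵐ y ∂Measure.infinitePi ν, k y = h y := ke.symm.trans he
  have h2 := (measurePreserving_piecewise ν B).quasiMeasurePreserving.ae h1
  obtain ⟨z, hz⟩ := exists_ae_of_ae_prod h2
  refine ⟨fun y => h (B.piecewise y z), hm.comp ((measurable_piecewise_pi B).comp measurable_prodMk_right),
    fun y y' hy => hd fun i hi => ?_, ?_⟩
  · by_cases hiB : i ∈ B
    · simpa [hiB] using hy i ⟨hi, hiB⟩
    · simp [hiB]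
  · filter_upwards [ke, hz] with y hy hyz
    rw [hy, ← hyz]
    exact kd fun i hi => by simp [show i ∈ B from hi]

lemma EssDependsOn.exists_comp_eval {i : ι} (h : EssDependsOn ν f {i}) :
    ∃ g : Y i → Z, Measurable g ∧ ∀ᵐ y ∂Measure.infinitePi ν, f y = g (y i) := by
  obtain ⟨h, hm, hd, he⟩ := h
  obtain ⟨y₀⟩ := (Measure.infinitePi ν).nonempty_of_neZero
  refine ⟨fun x => h (Function.update y₀ i x), hm.comp (measurable_update y₀), ?_⟩
  filter_upwards [he] with y hy
  rw [hy]
  exact hd fun j hj => by obtain rfl : j = i := hj; simp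

omit [∀ i, IsProbabilityMeasure (ν i)] in
lemma essDependsOn_of_ae_eq_eval {i : ι} {g : Y i → Z} (hg : Measurable g)
    (h : ∀ᵐ y ∂Measure.infinitePi ν, f y = g (y i)) : EssDependsOn ν f {i} :=
  ⟨fun y => g (y i), by fun_prop, fun y y' hy => by simp [hy i rfl], h⟩

lemma EssDependsOn.exists_ae_eq_const (h : EssDependsOn ν f ∅) :
    ∃ c, ∀ᵐ y ∂Measure.infinitePi ν, f y = c := by
  obtain ⟨h, -, hd, he⟩ := h
  obtain ⟨y₀⟩ := (Measure.infinitePi ν).nonempty_of_neZero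
  refine ⟨h y₀, ?_⟩
  filter_upwards [he] with y hy
  rw [hy, hd.empty y y₀]

/-- A coordinate of a product cannot be a function of another coordinate, unless it is trivial. -/
lemma eq_of_ae_eval_eq {i j : ι} [StandardBorelSpace (Y j)] (hj : IsNontrivial (ν j))
    {g : Y i → Y j} (hg : Measurable g)
    (h : ∀ᵐ y ∂Measure.infinitePi ν, y j = g (y i)) : i = j := by
  by_contra hij
  have h1 : EssDependsOn ν (fun y => y j) {i} := essDependsOn_of_ae_eq_eval hg h
  have h2 : EssDependsOn ν (fun y => y j) {j} :=
    essDependsOn_of_ae_eq_eval measurable_id (by simp)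
  have h3 := h1.inter h2
  rw [Set.singleton_inter_eq_empty.2 (by simpa using hij)] at h3
  obtain ⟨c, hc⟩ := h3.exists_ae_eq_const
  exact not_isNontrivial_of_ae_eq_const (ae_of_ae_comp (measurePreserving_eval_infinitePi ν j)
    (measurableSet_eq_fun measurable_id measurable_const) hc) hj

end Piecewise

/-! ### The zero-one law -/

section Tail

open scoped Classical

variable {Y : ℕ → Type*} [∀ i, MeasurableSpace (Y i)] {ν : ∀ i, Measure (Y i)}
  [∀ i, IsProbabilityMeasure (ν i)] {Z : Type*} [MeasurableSpace Z] {f : (∀ i, Y i) → Z}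

/-- Kolmogorov's zero-one law, for functions depending on the tail modulo null sets. -/
theorem measure_preimage_eq_zero_or_one_of_tail
    (h : ∀ n, EssDependsOn ν f (Set.Ici n)) {C : Set Z} (hC : MeasurableSet C) :
    Measure.infinitePi ν (f ⁻¹' C) = 0 ∨ Measure.infinitePi ν (f ⁻¹' C) = 1 := by
  obtain ⟨k, km, -, ke⟩ := h 0
  have hEk : f ⁻¹' C =ᵐ[Measure.infinitePi ν] k ⁻¹' C := ke.preimage C
  set E := k ⁻¹' C
  have hE : MeasurableSet E := km hC
  rw [measure_congr hEk]
  refine or_iff_not_imp_left.2 fun h0 => ?_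
  -- Conditioning on `E` does not change the measure of any box, hence not the measure; but `E` has
  -- conditional probability `1`.
  have hcond : (ProbabilityTheory.cond (Measure.infinitePi ν) E) = Measure.infinitePi ν := by
    refine Measure.eq_infinitePi _ fun s t ht => ?_
    -- The box constrains only coordinates up to `n`, while `E` has a version depending on those
    -- from `n + 1` on, so the two are independent.
    obtain ⟨n, hn⟩ := s.bddAbove
    obtain ⟨l, lm, ld, le⟩ := h (n + 1)
    obtain ⟨A, hA⟩ : ∃ A, A = Set.Iic n := ⟨_, rfl⟩
    have hEl : E =ᵐ[Measure.infinitePi ν] l ⁻¹' C := hEk.symm.trans (le.preimage C)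
    have hbox : MeasurableSet ((s : Set ℕ).pi t) :=
      MeasurableSet.pi s.countable_toSet fun i _ => ht i
    rw [ProbabilityTheory.cond_apply hE, Set.inter_comm,
      measure_congr ((ae_eq_refl _).inter hEl),
      infinitePi_inter_of_dependsOn ν A hbox (lm hC), measure_congr hEl,
      Measure.infinitePi_pi _ (fun i _ => ht i), mul_comm, mul_assoc, ENNReal.mul_inv_cancel, mul_one]
    · rwa [← measure_congr hEl]
    · exact measure_ne_top _ _
    · intro y z
      simp only [Set.mem_pi, Finset.mem_coe]
      refine forall₂_congr fun i hi => ?_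
      rw [Set.piecewise_eq_of_mem _ _ _ (hA ▸ hn hi)]
    · intro y z
      have : l (A.piecewise y z) = l z := ld fun i hi =>
        Set.piecewise_eq_of_notMem _ _ _ (hA ▸ not_le.2 (Nat.lt_of_succ_le hi))
      simp [this]
  rw [← hcond]
  exact ProbabilityTheory.cond_apply_self h0 (measure_ne_top _ _)

/-- All preimages have measure `0` or `1`, and countably many measurable sets separate the points of
`Z`, so `f` is almost everywhere constant. -/
theorem essDependsOn_empty_of_tail [StandardBorelSpace Z]
    (h : ∀ n, EssDependsOn ν f (Set.Ici n)) : EssDependsOn ν f ∅ := by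
  obtain ⟨y₀⟩ := (Measure.infinitePi ν).nonempty_of_neZero
  have : Nonempty Z := ⟨f y₀⟩
  obtain ⟨k, km, -, ke⟩ := h 0
  obtain ⟨c, hc⟩ := exists_eventuallyEq_const_of_forall_separating (l := ae (Measure.infinitePi ν))
    (f := f) MeasurableSet fun C hC => by
      have hn : NullMeasurableSet (f ⁻¹' C) (Measure.infinitePi ν) :=
        (km hC).nullMeasurableSet.congr (ke.preimage C).symm
      rcases measure_preimage_eq_zero_or_one_of_tail h hC with h | h
      · exact .inr (measure_eq_zero_iff_ae_notMem.1 h)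
      · exact .inl (mem_ae_iff_prob_eq_one₀ hn |>.2 h)
  exact ⟨fun _ => c, measurable_const, dependsOn_const c, hc⟩

end Tail

/-! ### JP factors of a product depend on one coordinate -/

section JoiningPrimeness

variable {Y : ℕ → Type u} [∀ i, MeasurableSpace (Y i)] [∀ i, StandardBorelSpace (Y i)]
  {ν : ∀ i, Measure (Y i)} [∀ i, IsProbabilityMeasure (ν i)] {S : ∀ i, ℝ → Y i → Y i}
  {X : Type u} [MeasurableSpace X] [StandardBorelSpace X] {μ : Measure X}
  {T : ℝ → X → X} {F : (∀ i, Y i) → X}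

omit [∀ i, StandardBorelSpace (Y i)] in
lemma IsWeaklyMixing.domRestrict (hS : ∀ i, IsFlow (S i) (ν i))
    (hw : IsWeaklyMixing (piFlow S) (Measure.infinitePi ν)) (A : Set ℕ) :
    IsWeaklyMixing (piFlow fun i : A => S i) (Measure.infinitePi fun i : A => ν i) :=
  hw.of_factor (fun t => (measurePreserving_piFlow (fun i : A => hS i) t).measurable)
    (φ := A.domRestrict) ⟨by fun_prop, Measure.infinitePi_map_restrict' ν⟩
    fun _ => ae_of_all _ fun _ => rfl

/-- A factor with the JP property of a weakly mixing product of flows is a factor of the product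
over `A` or of the product over the complement of `A`. -/
theorem HasJP.essDependsOn_or_compl (hT : IsFlow T μ) (hjp : HasJP T μ)
    (hS : ∀ i, IsFlow (S i) (ν i))
    (hw : IsWeaklyMixing (piFlow S) (Measure.infinitePi ν))
    (hF : MeasurePreserving F (Measure.infinitePi ν) μ)
    (heq : ∀ t, F ∘ piFlow S t =ᵐ[Measure.infinitePi ν] T t ∘ F) (A : Set ℕ) :
    EssDependsOn ν F A ∨ EssDependsOn ν F Aᶜ := by
  classical
  set J : (∀ i, Y i) → X × ((∀ i : A, Y i) × (∀ i : (Aᶜ : Set ℕ), Y i)) :=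
    fun y => (F y, (A.domRestrict y, (Aᶜ).domRestrict y)) with hJdef
  have hFm := hF.measurable
  have hJm : Measurable J := by fun_prop
  obtain ⟨ρ, hρ⟩ : ∃ ρ, ρ = (Measure.infinitePi ν).map J := ⟨_, rfl⟩
  have hJ : MeasurePreserving J (Measure.infinitePi ν) ρ := ⟨hJm, hρ.symm⟩
  have : IsProbabilityMeasure ρ := hρ ▸ Measure.isProbabilityMeasure_map hJm.aemeasurable
  have hr := measurePreserving_domRestrict_prod ν A
  have hSA := fun t => measurePreserving_piFlow (fun i : A => hS i) t
  have hSA' := fun t => measurePreserving_piFlow (fun i : (Aᶜ : Set ℕ) => hS i) t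
  have hJeq : ∀ t, J ∘ piFlow S t =ᵐ[Measure.infinitePi ν]
      prodFlow T (prodFlow (piFlow fun i : A => S i) (piFlow fun i : (Aᶜ : Set ℕ) => S i)) t ∘ J := by
    intro t
    filter_upwards [heq t] with y hy
    exact Prod.ext hy rfl
  have hflow : ∀ t, Measurable (prodFlow T (prodFlow (piFlow fun i : A => S i)
      (piFlow fun i : (Aᶜ : Set ℕ) => S i)) t) := fun t =>
    (hT.measurePreserving t).measurable.prodMap ((hSA t).measurable.prodMap (hSA' t).measurable)
  have hjoin : IsErgodicJoining T μ (prodFlow (piFlow fun i : A => S i)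
      (piFlow fun i : (Aᶜ : Set ℕ) => S i)) ((Measure.infinitePi fun i : A => ν i).prod
        (Measure.infinitePi fun i : (Aᶜ : Set ℕ) => ν i)) ρ := by
    refine ⟨?_, ?_, invariant_of_factor (measurePreserving_piFlow hS) hflow hJ hJeq,
      hw.isErgodic.of_factor hJ hJeq⟩
    · rw [hρ, Measure.map_map (by fun_prop) hJm]
      exact hF.map_eq
    · rw [hρ, Measure.map_map (by fun_prop) hJm]
      exact hr.map_eq
  -- Reassembles a point from its two blocks, so that `ρ` lives on the graph of `F ∘ G`.
  let G : (∀ i : A, Y i) × (∀ i : (Aᶜ : Set ℕ), Y i) → ∀ i, Y i :=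
    fun p i => if h : i ∈ A then p.1 ⟨i, h⟩ else p.2 ⟨i, h⟩
  have hG : Measurable G := by
    refine measurable_pi_iff.2 fun i => ?_
    by_cases hi : i ∈ A
    · simp only [G, hi, dite_true]; fun_prop
    · simp only [G, hi, dite_false]; fun_prop
  have hGr : ∀ y : ∀ i, Y i, G (A.domRestrict y, (Aᶜ).domRestrict y) = y := by
    intro y
    ext i
    by_cases hi : i ∈ A <;> simp [G, hi]
  have hgraph : ∀ᵐ p ∂ρ, p.1 = (F ∘ G) p.2 :=
    ae_of_ae_comp hJ (measurableSet_eq_fun (by fun_prop) (by fun_prop))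
      (ae_of_all _ fun y => by simp [J, hGr])
  rcases hjp.2 _ _ _ _ _ _ (IsFlow.pi fun i : A => hS i) (hw.domRestrict hS A)
    (IsFlow.pi fun i : (Aᶜ : Set ℕ) => hS i) (hw.domRestrict hS Aᶜ) ρ hjoin with h | h
  · left
    obtain ⟨b, hb⟩ := exists_ae_eq_of_eq_prod_left hgraph h
    refine ⟨fun y => F (G (A.domRestrict y, b)), by fun_prop, fun y y' hy => ?_,
      hJ.quasiMeasurePreserving.ae hb⟩
    have : A.domRestrict y = A.domRestrict y' := funext fun i => hy i i.2
    simp only [this]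
  · right
    obtain ⟨a, ha⟩ := exists_ae_eq_of_eq_prod_right hgraph h
    refine ⟨fun y => F (G (a, (Aᶜ).domRestrict y)), by fun_prop, fun y y' hy => ?_,
      hJ.quasiMeasurePreserving.ae ha⟩
    have : (Aᶜ).domRestrict y = (Aᶜ).domRestrict y' := funext fun i => hy i i.2
    simp only [this]

/-- A factor with the JP property of a weakly mixing product of flows is a factor of one of the
flows. -/
theorem HasJP.exists_ae_eq_comp_eval (hT : IsFlow T μ) (hjp : HasJP T μ)
    (hS : ∀ i, IsFlow (S i) (ν i))
    (hw : IsWeaklyMixing (piFlow S) (Measure.infinitePi ν))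
    (hF : MeasurePreserving F (Measure.infinitePi ν) μ)
    (heq : ∀ t, F ∘ piFlow S t =ᵐ[Measure.infinitePi ν] T t ∘ F) :
    ∃ i, ∃ g : Y i → X, Measurable g ∧ ∀ᵐ y ∂Measure.infinitePi ν, F y = g (y i) := by
  classical
  suffices ∃ i, EssDependsOn ν F {i} from this.imp fun i hi => hi.exists_comp_eval
  by_cases htail : ∀ n, EssDependsOn ν F (Set.Ici n)
  · exact ⟨0, (essDependsOn_empty_of_tail htail).mono (Set.empty_subset _)⟩
  push Not at htail
  have hmin := Nat.find_spec htail
  have hlt : ∀ m < Nat.find htail, EssDependsOn ν F (Set.Ici m) := fun m hm =>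
    not_not.1 (Nat.find_min htail hm)
  cases hn : Nat.find htail with
  -- The tail from `0` is the whole index set, so it cannot be the first to fail.
  | zero =>
    refine absurd ⟨F, hF.measurable, ?_, ae_eq_refl F⟩ (hn ▸ hmin)
    exact (dependsOn_univ F).mono fun i _ => Nat.zero_le i
  | succ n =>
    rw [hn] at hmin hlt
    -- The tail from `n + 1` fails, so its complement determines `F`; so does the tail from `n`, and
    -- the two sets meet only in `n`.
    have h1 := (hjp.essDependsOn_or_compl hT hS hw hF heq (Set.Ici (n + 1))).resolve_left hmin
    refine ⟨n, (h1.inter (hlt n n.lt_succ_self)).mono fun i hi => ?_⟩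
    simp only [Set.compl_Ici, Set.mem_inter_iff, Set.mem_Iio, Set.mem_Ici] at hi
    exact Set.mem_singleton_iff.2 (by omega)

end JoiningPrimeness

/-! ### Isomorphisms of flows and their inverses -/

section FlowIso

variable {X Y : Type*} [MeasurableSpace X] [MeasurableSpace Y] {S : ℝ → Y → Y} {ν : Measure Y}
  {T : ℝ → X → X} {μ : Measure X} {φ : Y → X}

/-- A left inverse suffices: `φ (ψ (φ y)) = φ y` holds almost everywhere, and `φ` carries `ν` to
`μ`. -/
lemma IsFlowIso.of_leftInverse [StandardBorelSpace X] (hφ : MeasurePreserving φ ν μ)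
    (heq : ∀ t, φ ∘ S t =ᵐ[ν] T t ∘ φ) {ψ : X → Y} (hψ : Measurable ψ)
    (h : ∀ᵐ y ∂ν, ψ (φ y) = y) : IsFlowIso S ν T μ φ := by
  refine ⟨hφ, ⟨ψ, hψ, h, ?_⟩, heq⟩
  refine ae_of_ae_comp hφ
    (measurableSet_eq_fun (hφ.measurable.comp hψ) measurable_id) ?_
  filter_upwards [h] with y hy
  simp [hy]

/-- An inverse of an isomorphism of flows is measure preserving and equivariant. -/
lemma IsFlowIso.exists_inverse_factor [StandardBorelSpace Y] (h : IsFlowIso S ν T μ φ)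
    (hS : ∀ t, MeasurePreserving (S t) ν ν) (hT : ∀ t, MeasurePreserving (T t) μ μ) :
    ∃ ψ : X → Y, MeasurePreserving ψ μ ν ∧ (∀ t, ψ ∘ T t =ᵐ[μ] S t ∘ ψ) ∧
      (∀ᵐ y ∂ν, ψ (φ y) = y) ∧ ∀ᵐ x ∂μ, φ (ψ x) = x := by
  obtain ⟨hφ, ⟨ψ, hψ, h1, h2⟩, heq⟩ := h
  refine ⟨ψ, ⟨hψ, ?_⟩, fun t => ?_, h1, h2⟩
  · rw [← hφ.map_eq, Measure.map_map hψ hφ.measurable, Measure.map_congr h1, Measure.map_id]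
  · refine ae_of_ae_comp hφ (measurableSet_eq_fun (hψ.comp (hT t).measurable)
      ((hS t).measurable.comp hψ)) ?_
    filter_upwards [h1, (hS t).quasiMeasurePreserving.ae h1, heq t] with y hy hSy hty
    simp only [Function.comp_apply, id] at hy hSy hty ⊢
    rw [← hty, hSy, hy]

end FlowIso

/-! ### Factor maps that are functions of one coordinate -/

section Coordinate

variable {ι : Type*} {Y : ι → Type*} [∀ i, MeasurableSpace (Y i)]
  {ν : ∀ i, Measure (Y i)} [∀ i, IsProbabilityMeasure (ν i)] {S : ∀ i, ℝ → Y i → Y i}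
  {W : Type*} [MeasurableSpace W] {μ : Measure W} {T : ℝ → W → W}
  {F : (∀ i, Y i) → W} {i : ι} {φ : Y i → W}

lemma measurePreserving_of_ae_eq_eval (hF : MeasurePreserving F (Measure.infinitePi ν) μ)
    (hφ : Measurable φ) (h : ∀ᵐ y ∂Measure.infinitePi ν, F y = φ (y i)) :
    MeasurePreserving φ (ν i) μ := by
  refine ⟨hφ, ?_⟩
  rw [← hF.map_eq, Measure.map_congr h, ← Measure.infinitePi_map_eval ν i,
    Measure.map_map hφ (by fun_prop)]
  rfl

lemma equivariant_of_ae_eq_eval [StandardBorelSpace W] (hS : ∀ i, IsFlow (S i) (ν i))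
    (hT : ∀ t, Measurable (T t)) (heq : ∀ t, F ∘ piFlow S t =ᵐ[Measure.infinitePi ν] T t ∘ F)
    (hφ : Measurable φ) (h : ∀ᵐ y ∂Measure.infinitePi ν, F y = φ (y i)) (t : ℝ) :
    φ ∘ S i t =ᵐ[ν i] T t ∘ φ := by
  refine ae_of_ae_comp (measurePreserving_eval_infinitePi ν i)
    (measurableSet_eq_fun (hφ.comp ((hS i).measurePreserving t).measurable) ((hT t).comp hφ)) ?_
  filter_upwards [h, heq t, (measurePreserving_piFlow hS t).quasiMeasurePreserving.ae h]
    with y h1 h2 h3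
  simp only [Function.comp_apply, Function.eval] at h2 ⊢
  rw [← h1, ← h2, h3]
  rfl

end Coordinate

/-! ### From coordinate maps to the partition and the permutation -/

section Decomposition

variable {X Y : ℕ → Type*} [∀ i, MeasurableSpace (X i)] [∀ i, StandardBorelSpace (X i)]
  [∀ i, MeasurableSpace (Y i)] [∀ i, StandardBorelSpace (Y i)]
  {μ : ∀ i, Measure (X i)} [∀ i, IsProbabilityMeasure (μ i)]
  {ν : ∀ i, Measure (Y i)} [∀ i, IsProbabilityMeasure (ν i)]
  {T : ∀ i, ℝ → X i → X i} {S : ∀ i, ℝ → Y i → Y i}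
  {Φ : (∀ i, Y i) → ∀ i, X i}

omit [∀ i, StandardBorelSpace (X i)] in
/-- Only the coordinates of `Φ` that are functions of `y i` are needed to recover `y i`. -/
lemma exists_leftInverse_of_ae_eq_eval {Ψ : (∀ i, X i) → ∀ i, Y i} (hΨ : Measurable Ψ)
    (hΨΦ : ∀ᵐ y ∂Measure.infinitePi ν, Ψ (Φ y) = y) {a : ℕ → ℕ} {g : ∀ i j, Y i → X j}
    (hg : ∀ i j, Measurable (g i j))
    (h : ∀ j, ∀ᵐ y ∂Measure.infinitePi ν, Φ y j = g (a j) j (y (a j))) (i : ℕ) :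
    ∃ ψ : (∀ j : {j | a j = i}, X j) → Y i, Measurable ψ ∧
      ∀ᵐ u ∂ν i, ψ (fun j => g i j u) = u := by
  classical
  have h1 : ∀ᵐ y ∂Measure.infinitePi ν, y i = Ψ (fun j => g (a j) j (y (a j))) i := by
    filter_upwards [hΨΦ, ae_all_iff.2 h] with y hy hj
    rw [← funext hj, hy]
  obtain ⟨A, hA⟩ : ∃ A : Set ℕ, ∀ k, k ∈ A ↔ k = i := ⟨{i}, fun _ => Iff.rfl⟩
  -- `z` supplies frozen values for all coordinates of `y` other than `i`.
  obtain ⟨z, hz⟩ := exists_ae_of_ae_prod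
    ((measurePreserving_piecewise ν A).quasiMeasurePreserving.ae h1)
  -- Extends `x` to a full point: outside the fibre over `i`, the coordinates of `Φ` do not involve
  -- `y i`, so their values at `z` are used.
  let E : (∀ j : {j | a j = i}, X j) → ∀ j, X j := fun x j =>
    if hj : a j = i then x ⟨j, hj⟩ else g (a j) j (z (a j))
  have hE : Measurable E := by
    refine measurable_pi_iff.2 fun j => ?_
    by_cases hj : a j = i
    · simp only [E, hj, dite_true]; fun_prop
    · simp only [E, hj, dite_false]; fun_prop
  have hψ : Measurable fun x => Ψ (E x) i := by fun_prop
  refine ⟨fun x => Ψ (E x) i, hψ, ?_⟩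
  refine ae_of_ae_comp (measurePreserving_eval_infinitePi ν i)
    (measurableSet_eq_fun (hψ.comp (measurable_pi_iff.2 fun j => hg i j)) measurable_id) ?_
  filter_upwards [hz] with y hy
  rw [Set.piecewise_eq_of_mem _ _ _ ((hA i).2 rfl)] at hy
  simp only [Function.eval]
  conv_rhs => rw [hy]
  congr 2
  ext j
  by_cases hj : a j = i
  · simp only [E, hj, dite_true]
    have : ∀ k, k = i → g i j (y i) = g k j (A.piecewise y z k) := by
      rintro k rfl
      simp [hA]
    exact this _ hj
  · simp [E, hj, hA]

/-- The coordinates of `Φ` over the fibre of `a` at `i` form a factor map of `S i`, and the left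
inverse just built makes it an isomorphism. -/
theorem exists_partition_isFlowIso (hT : ∀ i, IsFlow (T i) (μ i)) (hS : ∀ i, IsFlow (S i) (ν i))
    (hΦ : IsFlowIso (piFlow S) (Measure.infinitePi ν) (piFlow T) (Measure.infinitePi μ) Φ)
    {a : ℕ → ℕ} {g : ∀ i j, Y i → X j} (hg : ∀ i j, Measurable (g i j))
    (h : ∀ j, ∀ᵐ y ∂Measure.infinitePi ν, Φ y j = g (a j) j (y (a j))) (i : ℕ) :
    (IsNontrivial (ν i) → {j | a j = i}.Nonempty) ∧
    ∃ φ : Y i → ∀ j : {j | a j = i}, X j,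
      IsFlowIso (S i) (ν i) (piFlow fun j : {j | a j = i} => T j)
        (Measure.infinitePi fun j : {j | a j = i} => μ j) φ ∧
      ∀ᵐ y ∂(Measure.infinitePi ν), ∀ j : {j | a j = i}, Φ y j = φ (y i) j := by
  obtain ⟨Ψ, hΨ, hΨΦ, -⟩ := hΦ.exists_inverse
  obtain ⟨ψ, hψ, hψφ⟩ := exists_leftInverse_of_ae_eq_eval hΨ hΨΦ hg h i
  have hφ : Measurable fun (u : Y i) (j : {j | a j = i}) => g i j u :=
    measurable_pi_iff.2 fun j => hg i j
  have hae : ∀ᵐ y ∂Measure.infinitePi ν, ∀ j : {j | a j = i}, Φ y j = g i j (y i) := by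
    filter_upwards [ae_all_iff.2 h] with y hy
    rintro ⟨j, rfl⟩
    exact hy j
  have hae' : ∀ᵐ y ∂Measure.infinitePi ν,
      (({j | a j = i} : Set ℕ).domRestrict ∘ Φ) y = fun j : {j | a j = i} => g i j (y i) :=
    hae.mono fun y hy => funext hy
  have hF : MeasurePreserving (({j | a j = i} : Set ℕ).domRestrict ∘ Φ) (Measure.infinitePi ν)
      (Measure.infinitePi fun j : {j | a j = i} => μ j) :=
    MeasurePreserving.comp ⟨by fun_prop, Measure.infinitePi_map_restrict' μ⟩ hΦ.measurePreserving
  refine ⟨fun hν => ?_, fun u j => g i j u, ?_, hae⟩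
  · by_contra hempty
    -- Over an empty fibre the left inverse starts from a one-point space, so `y i` would be almost
    -- surely constant.
    have : IsEmpty {j | a j = i} := Set.isEmpty_coe_sort.2 (Set.not_nonempty_iff_eq_empty.1 hempty)
    refine not_isNontrivial_of_ae_eq_const (c := ψ isEmptyElim) ?_ hν
    filter_upwards [hψφ] with u hu
    rw [← hu]
    congr 1
    exact Subsingleton.elim _ _
  · refine .of_leftInverse (measurePreserving_of_ae_eq_eval hF hφ hae') ?_ hψ hψφ
    refine equivariant_of_ae_eq_eval hS
      (fun t => (measurePreserving_piFlow (fun j : {j | a j = i} => hT j) t).measurable)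
      (fun t => ?_) hφ hae'
    filter_upwards [hΦ.equivariant t] with y hy
    exact congrArg (({j | a j = i} : Set ℕ).domRestrict) hy

/-- If both `Φ` and its inverse act coordinate by coordinate up to reindexing, then so do the
isomorphisms they induce between the factors. -/
theorem exists_perm_isFlowIso (hT : ∀ i, IsFlow (T i) (μ i)) (hS : ∀ i, IsFlow (S i) (ν i))
    (hΦ : MeasurePreserving Φ (Measure.infinitePi ν) (Measure.infinitePi μ))
    (heq : ∀ t, Φ ∘ piFlow S t =ᵐ[Measure.infinitePi ν] piFlow T t ∘ Φ)
    {Ψ : (∀ i, X i) → ∀ i, Y i}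
    (hΨ : MeasurePreserving Ψ (Measure.infinitePi μ) (Measure.infinitePi ν))
    (hΨΦ : ∀ᵐ y ∂Measure.infinitePi ν, Ψ (Φ y) = y)
    (hΦΨ : ∀ᵐ x ∂Measure.infinitePi μ, Φ (Ψ x) = x)
    (hμ : ∀ i, IsNontrivial (μ i)) (hν : ∀ i, IsNontrivial (ν i))
    {a : ℕ → ℕ} {g : ∀ i j, Y i → X j} (hg : ∀ i j, Measurable (g i j))
    (ha : ∀ j, ∀ᵐ y ∂Measure.infinitePi ν, Φ y j = g (a j) j (y (a j)))
    {b : ℕ → ℕ} {k : ∀ i j, X i → Y j} (hk : ∀ i j, Measurable (k i j))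
    (hb : ∀ j, ∀ᵐ x ∂Measure.infinitePi μ, Ψ x j = k (b j) j (x (b j))) :
    ∃ σ : Equiv.Perm ℕ, ∀ i, ∃ φ : Y (σ i) → X i,
      IsFlowIso (S (σ i)) (ν (σ i)) (T i) (μ i) φ ∧
      ∀ᵐ y ∂(Measure.infinitePi ν), Φ y i = φ (y (σ i)) := by
  -- Going through `Ψ` and then `Φ` expresses `x j` as a function of `x (b (a j))`; distinct
  -- coordinates are independent and `μ j` is nontrivial.
  have hba : ∀ j, b (a j) = j := fun j => by
    refine eq_of_ae_eval_eq (ν := μ) (hμ j) ((hg (a j) j).comp (hk (b (a j)) (a j))) ?_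
    filter_upwards [hΦΨ, hΨ.quasiMeasurePreserving.ae (ha j), hb (a j)] with x h1 h2 h3
    rw [h1, h3] at h2
    exact h2
  have hab : ∀ j, a (b j) = j := fun j => by
    refine eq_of_ae_eval_eq (ν := ν) (hν j) ((hk (b j) j).comp (hg (a (b j)) (b j))) ?_
    filter_upwards [hΨΦ, hΦ.quasiMeasurePreserving.ae (hb j), ha (b j)] with x h1 h2 h3
    rw [h1, h3] at h2
    exact h2
  refine ⟨⟨a, b, hba, hab⟩, fun i => ⟨g (a i) i, ?_, ha i⟩⟩
  have hF : MeasurePreserving (fun y => Φ y i) (Measure.infinitePi ν) (μ i) :=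
    (measurePreserving_eval_infinitePi μ i).comp hΦ
  refine .of_leftInverse (measurePreserving_of_ae_eq_eval hF (hg _ _) (ha i))
    (equivariant_of_ae_eq_eval hS (fun t => ((hT i).measurePreserving t).measurable)
      (fun t => ?_) (hg _ _) (ha i)) (hk i (a i)) ?_
  · filter_upwards [heq t] with y hy
    exact congrFun hy i
  · refine ae_of_ae_comp (measurePreserving_eval_infinitePi ν (a i))
      (measurableSet_eq_fun ((hk _ _).comp (hg _ _)) measurable_id) ?_
    have hb' : ∀ᵐ x ∂Measure.infinitePi μ, Ψ x (a i) = k i (a i) (x i) := by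
      have := hb (a i)
      rwa [hba i] at this
    filter_upwards [hΨΦ, hΦ.quasiMeasurePreserving.ae hb', ha i] with y h1 h2 h3
    rw [h1, h3] at h2
    exact h2.symm

end Decomposition

/-! ### Choosing the coordinate maps -/

section Coordinates

variable {X Y : ℕ → Type u} [∀ i, MeasurableSpace (X i)] [∀ i, StandardBorelSpace (X i)]
  [∀ i, MeasurableSpace (Y i)] [∀ i, StandardBorelSpace (Y i)]
  {μ : ∀ i, Measure (X i)} [∀ i, IsProbabilityMeasure (μ i)]
  {ν : ∀ i, Measure (Y i)} [∀ i, IsProbabilityMeasure (ν i)]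
  {T : ∀ i, ℝ → X i → X i} {S : ∀ i, ℝ → Y i → Y i}
  {Φ : (∀ i, Y i) → ∀ i, X i}

/-- Each coordinate of a factor map between products of flows is a function of one coordinate, if
the source is weakly mixing and the flows in the target have the JP property. -/
theorem exists_coordinate_maps (hT : ∀ i, IsFlow (T i) (μ i)) (hjp : ∀ i, HasJP (T i) (μ i))
    (hS : ∀ i, IsFlow (S i) (ν i)) (hw : IsWeaklyMixing (piFlow S) (Measure.infinitePi ν))
    (hΦ : MeasurePreserving Φ (Measure.infinitePi ν) (Measure.infinitePi μ))
    (heq : ∀ t, Φ ∘ piFlow S t =ᵐ[Measure.infinitePi ν] piFlow T t ∘ Φ) :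
    ∃ (a : ℕ → ℕ) (g : ∀ i j, Y i → X j), (∀ i j, Measurable (g i j)) ∧
      ∀ j, ∀ᵐ y ∂Measure.infinitePi ν, Φ y j = g (a j) j (y (a j)) := by
  have hX : ∀ j, Nonempty (X j) := fun j => (μ j).nonempty_of_neZero
  have key : ∀ j, ∃ i, ∃ g : Y i → X j, Measurable g ∧
      ∀ᵐ y ∂Measure.infinitePi ν, Φ y j = g (y i) := fun j =>
    (hjp j).exists_ae_eq_comp_eval (hT j) hS hw
      ((measurePreserving_eval_infinitePi μ j).comp hΦ) fun t =>
        (heq t).mono fun y hy => congrFun hy j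
  choose a ha using key
  -- The maps are defined for all pairs, with a constant as junk value when `a j ≠ i`, so that on a
  -- fibre `a j = i` the map can be taken with domain `Y i` itself.
  have key' : ∀ i j, ∃ g : Y i → X j, Measurable g ∧
      (a j = i → ∀ᵐ y ∂Measure.infinitePi ν, Φ y j = g (y i)) := fun i j => by
    by_cases hij : a j = i
    · subst hij
      exact (ha j).imp fun g hg => ⟨hg.1, fun _ => hg.2⟩
    · exact ⟨fun _ => (hX j).some, measurable_const, fun h => absurd h hij⟩
  choose g hg h using key'
  exact ⟨a, g, hg, fun j => h _ j rfl⟩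

end Coordinates

end MeasFlow

/-! ### The decomposition theorem -/

theorem mainTheorem4
    (X Y : ℕ → Type u)
    [∀ i, MeasurableSpace (X i)] [∀ i, StandardBorelSpace (X i)]
    [∀ i, MeasurableSpace (Y i)] [∀ i, StandardBorelSpace (Y i)]
    (μ : ∀ i, Measure (X i)) [∀ i, IsProbabilityMeasure (μ i)]
    (ν : ∀ i, Measure (Y i)) [∀ i, IsProbabilityMeasure (ν i)]
    (T : ∀ i, ℝ → X i → X i) (S : ∀ i, ℝ → Y i → Y i)
    (hT : ∀ i, MeasFlow.IsFlow (T i) (μ i))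
    (hTwm : ∀ i, MeasFlow.IsWeaklyMixing (T i) (μ i))
    (hTjp : ∀ i, MeasFlow.HasJP (T i) (μ i))
    (hS : ∀ i, MeasFlow.IsFlow (S i) (ν i))
    (Φ : (∀ i, Y i) → ∀ i, X i)
    (hΦ : MeasFlow.IsFlowIso (MeasFlow.piFlow S) (Measure.infinitePi ν)
      (MeasFlow.piFlow T) (Measure.infinitePi μ) Φ) :
    (∃ N : ℕ → Set ℕ,
      (∀ i i', i ≠ i' → Disjoint (N i) (N i')) ∧ (⋃ i, N i) = Set.univ ∧
      (∀ i, MeasFlow.IsNontrivial (ν i) → (N i).Nonempty) ∧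
      ∀ i, ∃ φ : Y i → ∀ j : N i, X j,
        MeasFlow.IsFlowIso (S i) (ν i)
          (MeasFlow.piFlow fun j : N i => T j) (Measure.infinitePi fun j : N i => μ j) φ ∧
        ∀ᵐ y ∂(Measure.infinitePi ν), ∀ j : N i, Φ y j = φ (y i) j) ∧
    ((∀ i, MeasFlow.IsNontrivial (μ i)) → (∀ i, MeasFlow.IsNontrivial (ν i)) →
      (∀ i, MeasFlow.HasJP (S i) (ν i)) →
      ∃ σ : Equiv.Perm ℕ, ∀ i, ∃ φ : Y (σ i) → X i,
        MeasFlow.IsFlowIso (S (σ i)) (ν (σ i)) (T i) (μ i) φ ∧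
        ∀ᵐ y ∂(Measure.infinitePi ν), Φ y i = φ (y (σ i))) := by
  have hTpi := MeasFlow.measurePreserving_piFlow hT
  have hSpi := MeasFlow.measurePreserving_piFlow hS
  obtain ⟨Ψ, hΨ, hΨeq, hΨΦ, hΦΨ⟩ := hΦ.exists_inverse_factor hSpi hTpi
  have hwT := MeasFlow.IsWeaklyMixing.pi hT hTwm
  -- The `S i` are not assumed weakly mixing; their product is, as a factor of the product of the `T
  -- i` under `Ψ`.
  have hwS := hwT.of_factor (fun t => (hSpi t).measurable) hΨ hΨeq
  obtain ⟨a, g, hg, ha⟩ :=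
    MeasFlow.exists_coordinate_maps hT hTjp hS hwS hΦ.measurePreserving hΦ.equivariant
  have hpart := MeasFlow.exists_partition_isFlowIso hT hS hΦ hg ha
  refine ⟨⟨fun i => {j | a j = i}, fun i i' hii' => ?_, ?_, fun i => (hpart i).1,
    fun i => (hpart i).2⟩, fun hμ hν hSjp => ?_⟩
  · exact Set.disjoint_left.2 fun j hj hj' => hii' (hj.symm.trans hj')
  · exact Set.eq_univ_of_forall fun j => Set.mem_iUnion.2 ⟨a j, rfl⟩
  -- The same argument with the roles of the two products exchanged.
  · obtain ⟨b, k, hk, hb⟩ := MeasFlow.exists_coordinate_maps hS hSjp hT hwT hΨ hΨeq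
    exact MeasFlow.exists_perm_isFlowIso hT hS hΦ.measurePreserving hΦ.equivariant hΨ hΨΦ hΦΨ
      hμ hν hg ha hk hb
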